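/- **Language.** Terms are built from variables and the constants $\mathsf k,\mathsf s,\mathsf p,\mathsf p_0,\mathsf p_1,\mathsf c_{\mathsf W},\epsilon,\mathsf s_0,\mathsf s_1,\mathsf p_{\mathsf W},\mathsf s_\ell,\mathsf p_\ell,\mathsf c_\subseteq,*,\times$ by binary application (written by juxtaposition, $x*y:={*}\,x\,y$, $x\times y:={\times}\,x\,y$). Formulas are the first-order formulas built from the atoms $\mathsf W(t)$ and $s=t$ by $\neg,\wedge,\vee,\to,\forall,\exists$. A formula is *positive* if it contains neither $\neg$ nor $\to$, and *$\mathsf W$-free* if $\mathsf W$ does not occur in it. Put $0:=\mathsf s_0\epsilon$, $1:=\mathsf s_1\epsilon$, $s\subseteq t:=(\mathsf c_\subseteq\,s\,t=0)$, $s\le t:=(1\times s\subseteq 1\times t)$. Let $\mathsf c_\succeq$ be a closed term, $s\succeq t:=(\mathsf c_\succeq\,s\,t=0)$, and $\exists x\succeq t.\,\phi:=\exists x.\,\mathsf W(x)\wedge x\succeq t\wedge\phi$. (The intended $\mathsf c_\succeq$ represents the relation "$|v|<|w|$, or $|v|=|w|$ and $v_i\le w_i$ for all $i$" between binary words $w,v$;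 the theorem holds for every closed term $\mathsf c_\succeq$.) **The calculus $\mathsf{APH}^+$.** It derives sequents $\Gamma\Rightarrow\Delta$ of finite sequences of formulas by the rules of Gentzen's classical sequent calculus (identity $A\Rightarrow A$; weakening, contraction, exchange; cut; left and right rules for $\neg,\wedge,\vee,\to,\forall,\exists$), the following axioms for all terms, and two induction rules. All axioms consist of positive formulas. * Equality: $\Rightarrow x=x$; $\;x=y\Rightarrow y=x$; $\;x=y,\,y=z\Rightarrow x=z$; $\;x=x',\,y=y'\Rightarrow x\,y=x'\,y'$; $\;x=y,\,\mathsf W(x)\Rightarrow\mathsf W(y)$. * $\Rightarrow\mathsf k\,x\,y=x$; $\;\Rightarrow\mathsf s\,x\,y\,z=x\,z\,(y\,z)$; $\;\Rightarrow\mathsf p_0(\mathsf p\,x\,y)=x$; $\;\Rightarrow\mathsf p_1(\mathsf p\,x\,y)=y$. * $\Rightarrow\mathsf c_{\mathsf W}\,\epsilon\,x\,y\,z=x$; $\;\mathsf W(t)\Rightarrow\mathsf c_{\mathsf W}(\mathsf s_0t)\,x\,y\,z=y$; $\;\mathsf W(t)\Rightarrow\mathsf c_{\mathsf W}(\mathsf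 s_1t)\,x\,y\,z=z$. * $\Rightarrow\mathsf W(\epsilon)$; $\;\mathsf W(x)\Rightarrow\mathsf W(\mathsf s_ix)$; $\;\mathsf s_0x=\mathsf s_1x\Rightarrow$; $\;\mathsf s_ix=\epsilon\Rightarrow$; $\;\mathsf W(x)\Rightarrow\mathsf W(\mathsf p_{\mathsf W}x)$; $\;\Rightarrow\mathsf p_{\mathsf W}\epsilon=\epsilon$; $\;\mathsf W(x)\Rightarrow\mathsf p_{\mathsf W}(\mathsf s_ix)=x$; $\;\mathsf W(x)\Rightarrow x=\epsilon,\ \mathsf s_0(\mathsf p_{\mathsf W}x)=x\vee\mathsf s_1(\mathsf p_{\mathsf W}x)=x$ $\;(i=0,1)$. * $\mathsf W(x)\Rightarrow\mathsf W(\mathsf s_\ell x)$; $\;\Rightarrow\mathsf s_\ell\epsilon=0$; $\;\mathsf W(x)\Rightarrow\mathsf s_\ell(\mathsf s_0x)=\mathsf s_1x$; $\;\mathsf W(x)\Rightarrow\mathsf s_\ell(\mathsf s_1x)=\mathsf s_0(\mathsf s_\ell x)$; $\;\mathsf W(x)\Rightarrow\mathsf W(\mathsf p_\ell x)$; $\;\Rightarrow\mathsf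 p_\ell\epsilon=\epsilon$; $\;\mathsf W(x)\Rightarrow\mathsf p_\ell(\mathsf s_\ell x)=x$; $\;\mathsf W(x)\Rightarrow x=\epsilon,\ \mathsf s_\ell(\mathsf p_\ell x)=x$. * $\mathsf W(x),\mathsf W(y)\Rightarrow\mathsf c_\subseteq x\,y=0\vee\mathsf c_\subseteq x\,y=1$; $\;\mathsf W(x),x\subseteq\epsilon\Rightarrow x=\epsilon$; $\;\mathsf W(x),x=\epsilon\Rightarrow x\subseteq\epsilon$; $\;\mathsf W(x),\mathsf W(y),x\subseteq y\Rightarrow y=\epsilon,\ x\subseteq\mathsf p_{\mathsf W}y\vee x=y$; $\;\mathsf W(x),\mathsf W(y),\ x\subseteq\mathsf p_{\mathsf W}y\vee x=y\Rightarrow y=\epsilon,\ x\subseteq y$; $\;\mathsf W(x),\mathsf W(y),\mathsf W(z),x\subseteq y,y\subseteq z\Rightarrow x\subseteq z$. * $\mathsf W(x),\mathsf W(y)\Rightarrow\mathsf W(x*y)$; $\;\mathsf W(x)\Rightarrow x*\epsilon=x$; $\;\mathsf W(x),\mathsf W(y)\Rightarrow x*(\mathsf s_iy)=\mathsf s_i(x*y)$;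 $\;\mathsf W(x),\mathsf W(y)\Rightarrow\mathsf W(x\times y)$; $\;\mathsf W(x)\Rightarrow x\times\epsilon=\epsilon$; $\;\mathsf W(x),\mathsf W(y)\Rightarrow x\times\mathsf s_iy=(x\times y)*x$ $\;(i=0,1)$. * *Induction on notation*: from $\Gamma,\mathsf W(u)\Rightarrow\mathsf W(t\,u),\Delta$, and $\Gamma\Rightarrow\phi(\epsilon),\Delta$, and $\Gamma,\mathsf W(a),\phi(a)\Rightarrow\phi(\mathsf s_ia),\Delta$ for $i=0,1$, infer $\Gamma,\mathsf W(s)\Rightarrow\phi(s),\Delta$, where $\phi(x)$ is $\exists y.\,\mathsf W(y)\wedge y\le t\,x\wedge\psi(t,x,y)$ with $\psi$ positive and $\mathsf W$-free. * *Monotone induction*: from $\Gamma,\mathsf W(u)\Rightarrow\mathsf W(t\,u),\Delta$, and $\Gamma\Rightarrow\exists n.\,\mathsf W(n)\wedge\phi(\epsilon,n),\Delta$, and $\Gamma,\mathsf W(a),\mathsf W(b),\phi(a,b)\Rightarrow\exists m\succeq b.\,\phi(\mathsf s_\ell a,m),\Delta$, infer $\Gamma,\mathsf W(s)\Rightarrow\exists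 n.\,\mathsf W(n)\wedge\phi(s,n),\Delta$, where $\phi(x,n)$ is $n\le t\,x\wedge\psi(t,x,n)$ with $\psi$ positive, $\mathsf W$-free and without disjunctions. Here $s,t$ are arbitrary terms and $u$, $a$, $b$ are distinct fresh variables (eigenvariables). **Theorem (Partial cut elimination).** (i) In every instance of monotone induction the formulas $\mathsf W(s)$, $\exists n.\,\mathsf W(n)\wedge\phi(s,n)$, $\phi(a,b)$ and $\exists m\succeq b.\,\phi(\mathsf s_\ell a,m)$ are positive. (ii) For all sequents $\Gamma\Rightarrow\Delta$ (of arbitrary formulas): if $\Gamma\Rightarrow\Delta$ is derivable in $\mathsf{APH}^+$, then it has a derivation in $\mathsf{APH}^+$ in which all cut formulas are positive. -/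

import Mathlib

namespace APH

/-! ### Language: terms and formulas -/

/-- The individual constants of the applicative language. -/
inductive Const : Type
  /-- combinators -/
  | k | s
  /-- pairing and the two projections -/
  | p | p0 | p1
  /-- case distinction on words -/
  | cW
  /-- the empty word -/
  | eps
  /-- binary successors and binary predecessor -/
  | s0 | s1 | pW
  /-- lexicographic successor and predecessor -/
  | sl | pl
  /-- (characteristic function of) the initial subword relation -/
  | csub
  /-- word concatenation and word multiplication -/
  | cat | times

/-- Terms are built from variables and constants by (total) application.
Variables are de Bruijn indices: below `d` quantifiers the indices `0, …, d - 1` are bound,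
and `d + i` is the free variable number `i`. -/
inductive Term : Type
  | var (i : ℕ)
  | const (c : Const)
  | app (r t : Term)

namespace Term

/-- Closed terms, i.e. terms without variables. -/
def Closed : Term → Prop
  | var _ => False
  | const _ => True
  | app r t => r.Closed ∧ t.Closed

/-- Simultaneous substitution. -/
def subst (σ : ℕ → Term) : Term → Term
  | var i => σ i
  | const c => const c
  | app r t => app (r.subst σ) (t.subst σ)

/-- `t.lift n` is `t` seen in a context with `n` additional variables `0, …, n - 1`. -/
def lift (n : ℕ) (t : Term) : Term := t.subst fun i => var (i + n)

/-- Application of a constant to one argument. -/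
def ap1 (c : Const) (t : Term) : Term := app (const c) t

/-- Application of a constant to two arguments. -/
def ap2 (c : Const) (r t : Term) : Term := app (app (const c) r) t

/-- `ε` -/
def eps : Term := const Const.eps

/-- `0 := s₀ ε` -/
def zero : Term := ap1 Const.s0 eps

/-- `1 := s₁ ε` -/
def one : Term := ap1 Const.s1 eps

/-- The tally length `1 × t`. -/
def len (t : Term) : Term := ap2 Const.times one t

end Term

/-- The substitution mapping variable `0` to `t` and variable `i + 1` to `σ i`. -/
def scons (t : Term) (σ : ℕ → Term) : ℕ → Term
  | 0 => t
  | i + 1 => σ i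

/-- The substitution `σ` pushed below one quantifier. -/
def up (σ : ℕ → Term) : ℕ → Term := scons (Term.var 0) fun i => (σ i).lift 1

/-- First-order formulas over the relation symbols `W` and `=`. In `all A` and `ex A` the
quantified variable is the variable `0` of `A`. -/
inductive Formula : Type
  | W (t : Term)
  | eq (r t : Term)
  | neg (A : Formula)
  | and (A B : Formula)
  | or (A B : Formula)
  | imp (A B : Formula)
  | all (A : Formula)
  | ex (A : Formula)

namespace Formula

/-- Simultaneous (capture-avoiding) substitution. -/
def subst : (ℕ → Term) → Formula → Formula
  | σ, W t => W (t.subst σ)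
  | σ, eq r t => eq (r.subst σ) (t.subst σ)
  | σ, neg A => neg (A.subst σ)
  | σ, and A B => and (A.subst σ) (B.subst σ)
  | σ, or A B => or (A.subst σ) (B.subst σ)
  | σ, imp A B => imp (A.subst σ) (B.subst σ)
  | σ, all A => all (A.subst (up σ))
  | σ, ex A => ex (A.subst (up σ))

/-- `A.lift n` is `A` seen in a context with `n` additional variables `0, …, n - 1`. -/
def lift (n : ℕ) (A : Formula) : Formula := A.subst fun i => Term.var (i + n)

/-- `A(t)`: the variable `0` is replaced by `t`, and the other variables are renumbered. -/
def inst (A : Formula) (t : Term) : Formula := A.subst (scons t Term.var)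

/-- Positive formulas: free of negation and implication. -/
def Positive : Formula → Prop
  | W _ => True
  | eq _ _ => True
  | neg _ => False
  | and A B => A.Positive ∧ B.Positive
  | or A B => A.Positive ∧ B.Positive
  | imp _ _ => False
  | all A => A.Positive
  | ex A => A.Positive

/-- `W`-free formulas: the relation symbol `W` does not occur. -/
def WFree : Formula → Prop
  | W _ => False
  | eq _ _ => True
  | neg A => A.WFree
  | and A B => A.WFree ∧ B.WFree
  | or A B => A.WFree ∧ B.WFree
  | imp A B => A.WFree ∧ B.WFree
  | all A => A.WFree
  | ex A => A.WFree

/-- Formulas not containing disjunctions. -/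
def OrFree : Formula → Prop
  | W _ => True
  | eq _ _ => True
  | neg A => A.OrFree
  | and A B => A.OrFree ∧ B.OrFree
  | or _ _ => False
  | imp A B => A.OrFree ∧ B.OrFree
  | all A => A.OrFree
  | ex A => A.OrFree

/-- `r ⊆ t`, i.e. `c_⊆ r t = 0`. -/
def sub (r t : Term) : Formula := eq (Term.ap2 Const.csub r t) Term.zero

/-- `r ≤ t`, i.e. `1 × r ⊆ 1 × t`. -/
def le (r t : Term) : Formula := sub r.len t.len

/-- `r ⪰ t`, i.e. `c r t = 0`, where the closed term `c` stands for the characteristic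
function of the relation `⪰`. -/
def succeq (c r t : Term) : Formula := eq (Term.app (Term.app c r) t) Term.zero

/-- The formula `φ(x, n) := n ≤ t x ∧ ψ(x, n)`, where `n` is variable `0`, `x` is variable `1`,
and `t` (which lives in the context without `n` and `x`) may also occur in `ψ`. -/
def bounded (t : Term) (ψ : Formula) : Formula :=
  and (le (Term.var 0) (Term.app (t.lift 2) (Term.var 1))) ψ

/-- The formula `∃ n. W(n) ∧ φ(x, n)`, i.e. `∃ n ≤ t x. ψ(x, n)`, where `x` is variable `0`. -/
def exBounded (t : Term) (ψ : Formula) : Formula :=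
  ex (and (W (Term.var 0)) (bounded t ψ))

/-- The formula `∃ m ⪰ b. φ(s_ℓ a, m)`, i.e. `∃ m. W(m) ∧ m ⪰ b ∧ φ(s_ℓ a, m)`, where `b` is
variable `0` and `a` is variable `1`. (Below the quantifier, `m`, `b`, `a` are the variables
`0`, `1`, `2`.) -/
def exSucceq (c t : Term) (ψ : Formula) : Formula :=
  ex (and (W (Term.var 0)) (and (succeq c (Term.var 0) (Term.var 1))
    ((bounded t ψ).subst
      (scons (Term.var 0) (scons (Term.ap1 Const.sl (Term.var 2)) fun i => Term.var (i + 3))))))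

end Formula

open Term Formula

/-! ### The sequent calculus -/

/-- The non-logical axioms (including those for equality), as sequents `Γ ⇒ Δ` of positive
formulas. -/
inductive Ax : List Formula → List Formula → Prop
  -- equality
  | eq_refl (x : Term) : Ax [] [eq x x]
  | eq_symm (x y : Term) : Ax [eq x y] [eq y x]
  | eq_trans (x y z : Term) : Ax [eq x y, eq y z] [eq x z]
  | eq_app (x x' y y' : Term) : Ax [eq x x', eq y y'] [eq (app x y) (app x' y')]
  | eq_W (x y : Term) : Ax [eq x y, W x] [W y]
  -- combinatory algebra and pairing
  | k_eq (x y : Term) : Ax [] [eq (ap2 Const.k x y) x]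
  | s_eq (x y z : Term) : Ax [] [eq (app (ap2 Const.s x y) z) (app (app x z) (app y z))]
  | p0_eq (x y : Term) : Ax [] [eq (ap1 Const.p0 (ap2 Const.p x y)) x]
  | p1_eq (x y : Term) : Ax [] [eq (ap1 Const.p1 (ap2 Const.p x y)) y]
  -- definition by cases
  | cW_eps (x y z : Term) : Ax [] [eq (app (app (ap2 Const.cW eps x) y) z) x]
  | cW_s0 (t x y z : Term) :
      Ax [W t] [eq (app (app (ap2 Const.cW (ap1 Const.s0 t) x) y) z) y]
  | cW_s1 (t x y z : Term) :
      Ax [W t] [eq (app (app (ap2 Const.cW (ap1 Const.s1 t) x) y) z) z]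
  -- closure, binary successors and predecessor
  | W_eps : Ax [] [W eps]
  | W_s0 (x : Term) : Ax [W x] [W (ap1 Const.s0 x)]
  | W_s1 (x : Term) : Ax [W x] [W (ap1 Const.s1 x)]
  | s0_ne_s1 (x : Term) : Ax [eq (ap1 Const.s0 x) (ap1 Const.s1 x)] []
  | s0_ne_eps (x : Term) : Ax [eq (ap1 Const.s0 x) eps] []
  | s1_ne_eps (x : Term) : Ax [eq (ap1 Const.s1 x) eps] []
  | W_pW (x : Term) : Ax [W x] [W (ap1 Const.pW x)]
  | pW_eps : Ax [] [eq (ap1 Const.pW eps) eps]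
  | pW_s0 (x : Term) : Ax [W x] [eq (ap1 Const.pW (ap1 Const.s0 x)) x]
  | pW_s1 (x : Term) : Ax [W x] [eq (ap1 Const.pW (ap1 Const.s1 x)) x]
  | s_pW (x : Term) :
      Ax [W x] [eq x eps, or (eq (ap1 Const.s0 (ap1 Const.pW x)) x)
        (eq (ap1 Const.s1 (ap1 Const.pW x)) x)]
  -- lexicographic successor and predecessor
  | W_sl (x : Term) : Ax [W x] [W (ap1 Const.sl x)]
  | sl_eps : Ax [] [eq (ap1 Const.sl eps) zero]
  | sl_s0 (x : Term) : Ax [W x] [eq (ap1 Const.sl (ap1 Const.s0 x)) (ap1 Const.s1 x)]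
  | sl_s1 (x : Term) :
      Ax [W x] [eq (ap1 Const.sl (ap1 Const.s1 x)) (ap1 Const.s0 (ap1 Const.sl x))]
  | W_pl (x : Term) : Ax [W x] [W (ap1 Const.pl x)]
  | pl_eps : Ax [] [eq (ap1 Const.pl eps) eps]
  | pl_sl (x : Term) : Ax [W x] [eq (ap1 Const.pl (ap1 Const.sl x)) x]
  | sl_pl (x : Term) : Ax [W x] [eq x eps, eq (ap1 Const.sl (ap1 Const.pl x)) x]
  -- initial subword relation
  | sub_dec (x y : Term) :
      Ax [W x, W y] [or (eq (ap2 Const.csub x y) zero) (eq (ap2 Const.csub x y) one)]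
  | sub_eps (x : Term) : Ax [W x, sub x eps] [eq x eps]
  | eps_sub (x : Term) : Ax [W x, eq x eps] [sub x eps]
  | sub_step (x y : Term) :
      Ax [W x, W y, sub x y] [eq y eps, or (sub x (ap1 Const.pW y)) (eq x y)]
  | step_sub (x y : Term) :
      Ax [W x, W y, or (sub x (ap1 Const.pW y)) (eq x y)] [eq y eps, sub x y]
  | sub_trans (x y z : Term) : Ax [W x, W y, W z, sub x y, sub y z] [sub x z]
  -- word concatenation
  | W_cat (x y : Term) : Ax [W x, W y] [W (ap2 Const.cat x y)]
  | cat_eps (x : Term) : Ax [W x] [eq (ap2 Const.cat x eps) x]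
  | cat_s0 (x y : Term) :
      Ax [W x, W y] [eq (ap2 Const.cat x (ap1 Const.s0 y)) (ap1 Const.s0 (ap2 Const.cat x y))]
  | cat_s1 (x y : Term) :
      Ax [W x, W y] [eq (ap2 Const.cat x (ap1 Const.s1 y)) (ap1 Const.s1 (ap2 Const.cat x y))]
  -- word multiplication
  | W_times (x y : Term) : Ax [W x, W y] [W (ap2 Const.times x y)]
  | times_eps (x : Term) : Ax [W x] [eq (ap2 Const.times x eps) eps]
  | times_s0 (x y : Term) :
      Ax [W x, W y]
        [eq (ap2 Const.times x (ap1 Const.s0 y)) (ap2 Const.cat (ap2 Const.times x y) x)]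
  | times_s1 (x y : Term) :
      Ax [W x, W y]
        [eq (ap2 Const.times x (ap1 Const.s1 y)) (ap2 Const.cat (ap2 Const.times x y) x)]

/-- A list of formulas seen in a context with `n` additional (hence fresh) variables. -/
def liftAll (n : ℕ) (Γ : List Formula) : List Formula := Γ.map (Formula.lift n)

/-- `Derives c C Γ Δ`: the sequent `Γ ⇒ Δ` has a derivation in the calculus `APH⁺`, formed with
the closed term `c` for the characteristic function of `⪰`, in which every cut formula
satisfies `C`. Sequents are pairs of finite sequences. Eigenvariables are the fresh variables
`0` (and `1`) of a lifted context. -/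
inductive Derives (c : Term) (C : Formula → Prop) : List Formula → List Formula → Prop
  -- identity, structural rules (weakening, exchange and contraction at once), cut
  | id (A : Formula) : Derives c C [A] [A]
  | struct {Γ Γ' Δ Δ' : List Formula} :
      Γ ⊆ Γ' → Δ ⊆ Δ' → Derives c C Γ Δ → Derives c C Γ' Δ'
  | cut {Γ Δ : List Formula} (A : Formula) :
      C A → Derives c C Γ (A :: Δ) → Derives c C (A :: Γ) Δ → Derives c C Γ Δ
  -- logical rules
  | negL {Γ Δ : List Formula} {A : Formula} :
      Derives c C Γ (A :: Δ) → Derives c C (neg A :: Γ) Δ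
  | negR {Γ Δ : List Formula} {A : Formula} :
      Derives c C (A :: Γ) Δ → Derives c C Γ (neg A :: Δ)
  | andL {Γ Δ : List Formula} {A B : Formula} :
      Derives c C (A :: B :: Γ) Δ → Derives c C (and A B :: Γ) Δ
  | andR {Γ Δ : List Formula} {A B : Formula} :
      Derives c C Γ (A :: Δ) → Derives c C Γ (B :: Δ) → Derives c C Γ (and A B :: Δ)
  | orL {Γ Δ : List Formula} {A B : Formula} :
      Derives c C (A :: Γ) Δ → Derives c C (B :: Γ) Δ → Derives c C (or A B :: Γ) Δ
  | orR {Γ Δ : List Formula} {A B : Formula} :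
      Derives c C Γ (A :: B :: Δ) → Derives c C Γ (or A B :: Δ)
  | impL {Γ Δ : List Formula} {A B : Formula} :
      Derives c C Γ (A :: Δ) → Derives c C (B :: Γ) Δ → Derives c C (imp A B :: Γ) Δ
  | impR {Γ Δ : List Formula} {A B : Formula} :
      Derives c C (A :: Γ) (B :: Δ) → Derives c C Γ (imp A B :: Δ)
  | allL {Γ Δ : List Formula} {A : Formula} (t : Term) :
      Derives c C (A.inst t :: Γ) Δ → Derives c C (all A :: Γ) Δ
  | allR {Γ Δ : List Formula} {A : Formula} :
      Derives c C (liftAll 1 Γ) (A :: liftAll 1 Δ) → Derives c C Γ (all A :: Δ)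
  | exL {Γ Δ : List Formula} {A : Formula} :
      Derives c C (A :: liftAll 1 Γ) (liftAll 1 Δ) → Derives c C (ex A :: Γ) Δ
  | exR {Γ Δ : List Formula} {A : Formula} (t : Term) :
      Derives c C Γ (A.inst t :: Δ) → Derives c C Γ (ex A :: Δ)
  -- non-logical axioms
  | ax {Γ Δ : List Formula} : Ax Γ Δ → Derives c C Γ Δ
  /-- Induction on notation for `φ(x) := ∃ y ≤ t x. ψ(x, y)`. From
  `Γ, W(u) ⇒ W(t u), Δ` and `Γ ⇒ φ(ε), Δ` and `Γ, W(a), φ(a) ⇒ φ(sᵢ a), Δ` (`i = 0, 1`)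
  infer `Γ, W(s) ⇒ φ(s), Δ`. -/
  | notationInd {Γ Δ : List Formula} (t s : Term) (ψ : Formula) :
      ψ.Positive → ψ.WFree →
      Derives c C (W (var 0) :: liftAll 1 Γ) (W (app (t.lift 1) (var 0)) :: liftAll 1 Δ) →
      Derives c C Γ ((exBounded t ψ).inst eps :: Δ) →
      Derives c C (W (var 0) :: exBounded t ψ :: liftAll 1 Γ)
        ((exBounded t ψ).subst (scons (ap1 Const.s0 (var 0)) fun i => var (i + 1))
          :: liftAll 1 Δ) →
      Derives c C (W (var 0) :: exBounded t ψ :: liftAll 1 Γ)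
        ((exBounded t ψ).subst (scons (ap1 Const.s1 (var 0)) fun i => var (i + 1))
          :: liftAll 1 Δ) →
      Derives c C (W s :: Γ) ((exBounded t ψ).inst s :: Δ)
  /-- Monotone induction for `φ(x, n) := n ≤ t x ∧ ψ(x, n)`. From
  `Γ, W(u) ⇒ W(t u), Δ` and `Γ ⇒ ∃ n. W(n) ∧ φ(ε, n), Δ` and
  `Γ, W(a), W(b), φ(a, b) ⇒ ∃ m ⪰ b. φ(s_ℓ a, m), Δ`
  infer `Γ, W(s) ⇒ ∃ n. W(n) ∧ φ(s, n), Δ`. (In the third premise `a`, `b` are the variables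
  `1`, `0`.) -/
  | monotoneInd {Γ Δ : List Formula} (t s : Term) (ψ : Formula) :
      ψ.Positive → ψ.WFree → ψ.OrFree →
      Derives c C (W (var 0) :: liftAll 1 Γ) (W (app (t.lift 1) (var 0)) :: liftAll 1 Δ) →
      Derives c C Γ ((exBounded t ψ).inst eps :: Δ) →
      Derives c C (W (var 1) :: W (var 0) :: bounded t ψ :: liftAll 2 Γ)
        (exSucceq c t ψ :: liftAll 2 Δ) →
      Derives c C (W s :: Γ) ((exBounded t ψ).inst s :: Δ)

/-- `APH⁺ ⊢ Γ ⇒ Δ`: derivability, with arbitrary cuts. -/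
def Provable (c : Term) (Γ Δ : List Formula) : Prop := Derives c (fun _ => True) Γ Δ

/-- `APH⁺ ⊢⁎ Γ ⇒ Δ`: there is a derivation in which all cut formulas are positive. -/
def ProvablePosCut (c : Term) (Γ Δ : List Formula) : Prop := Derives c Formula.Positive Γ Δ

end APH

/-! The argument is semantic and classical: it builds no cut-reduction procedure. Suppose a sequent
has no derivation with positive cuts. It is extended to a pair `(L, R)` of sets of formulas
containing no sequent so derivable and closed under every rule read backwards; a cut on a positive
formula puts each such formula into `L` or `R`. Only countably many closure conditions arise, so a
Rasiowa–Sikorski argument meets them all (`Task.derives`, `exists_saturated`).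

In the model whose elements are the terms and whose true atoms are those in `L`, members of `L` are
true and members of `R` false (`truth`), and for positive formulas truth coincides with membership
in `L` (`sat_iff`). Arbitrary cuts are sound in any classical structure. Axioms and the principal
formulas of both induction rules are positive, so a failing axiom or induction inference would be
visible in `(L, R)`, which is excluded. Hence everything provable holds in the model (`sound`),
while the given sequent fails there. -/

namespace APH

open Term Formula

/-! ### Substitution -/

namespace Term

theorem subst_subst (σ τ : ℕ → Term) (t : Term) :
    (t.subst σ).subst τ = t.subst fun i => (σ i).subst τ := by
  induction t <;> simp_all [subst]

theorem subst_var (t : Term) : t.subst var = t := by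
  induction t <;> simp_all [subst]

theorem Closed.subst_eq {t : Term} (h : t.Closed) (σ : ℕ → Term) : t.subst σ = t := by
  induction t <;> simp_all [subst, Closed]

end Term

@[simp] theorem scons_zero (t : Term) (σ : ℕ → Term) : scons t σ 0 = t := rfl

@[simp] theorem scons_succ (t : Term) (σ : ℕ → Term) (i : ℕ) : scons t σ (i + 1) = σ i := rfl

@[simp] theorem scons_one (t : Term) (σ : ℕ → Term) : scons t σ 1 = σ 0 := rfl

theorem scons_comp (t : Term) (σ τ : ℕ → Term) :
    (fun i => (scons t σ i).subst τ) = scons (t.subst τ) fun i => (σ i).subst τ := by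
  funext i; cases i <;> rfl

theorem up_comp_scons (σ τ : ℕ → Term) (t : Term) :
    (fun i => (up σ i).subst (scons t τ)) = scons t fun i => (σ i).subst τ := by
  funext i
  cases i <;> simp [up, Term.subst, Term.lift, Term.subst_subst]

theorem up_comp (σ τ : ℕ → Term) :
    (fun i => (up σ i).subst (up τ)) = up fun i => (σ i).subst τ := by
  rw [up, up_comp_scons]
  simp [up, Term.lift, Term.subst_subst]

theorem up_var : up var = var := by
  funext i; cases i <;> simp [up, Term.lift, Term.subst]

namespace Formula

theorem subst_subst (A : Formula) (σ τ : ℕ → Term) :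
    (A.subst σ).subst τ = A.subst fun i => (σ i).subst τ := by
  induction A generalizing σ τ <;> simp_all [subst, Term.subst_subst, up_comp]

theorem subst_var (A : Formula) : A.subst var = A := by
  induction A <;> simp_all [subst, Term.subst_var, up_var]

theorem lift_subst_scons (A : Formula) (t : Term) (σ : ℕ → Term) :
    (A.lift 1).subst (scons t σ) = A.subst σ := by
  simp [lift, subst_subst, Term.subst]

theorem lift_lift (A : Formula) : (A.lift 1).lift 1 = A.lift 2 := by
  simp [lift, subst_subst, Term.subst, add_assoc]

theorem lift_one_subst_up (A : Formula) (σ : ℕ → Term) :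
    (A.lift 1).subst (up σ) = (A.subst σ).lift 1 := by
  rw [up, lift_subst_scons, lift, subst_subst]; rfl

theorem lift_two_subst_up (A : Formula) (σ : ℕ → Term) :
    (A.lift 2).subst (up (up σ)) = (A.subst σ).lift 2 := by
  rw [← lift_lift, lift_one_subst_up, lift_one_subst_up, lift_lift]

theorem inst_subst (A : Formula) (t : Term) (σ : ℕ → Term) :
    (A.inst t).subst σ = (A.subst (up σ)).inst (t.subst σ) := by
  simp [inst, subst_subst, up_comp_scons, scons_comp, Term.subst, Term.subst_var]

theorem subst_up_scons (A : Formula) (t : Term) (σ τ : ℕ → Term) :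
    (A.subst (up σ)).subst (scons t τ) = A.subst (scons t fun i => (σ i).subst τ) := by
  rw [subst_subst, up_comp_scons]

theorem inst_subst_up (A : Formula) (t : Term) (σ : ℕ → Term) :
    (A.subst (up σ)).inst t = A.subst (scons t σ) := by
  simp [inst, subst_up_scons, Term.subst_var]

/-! ### Stability and positivity of the induction formulas -/

theorem Positive.subst {A : Formula} (h : A.Positive) (σ : ℕ → Term) :
    (A.subst σ).Positive := by
  induction A generalizing σ <;> simp_all [Formula.subst, Positive]

theorem WFree.subst {A : Formula} (h : A.WFree) (σ : ℕ → Term) : (A.subst σ).WFree := by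
  induction A generalizing σ <;> simp_all [Formula.subst, WFree]

theorem OrFree.subst {A : Formula} (h : A.OrFree) (σ : ℕ → Term) : (A.subst σ).OrFree := by
  induction A generalizing σ <;> simp_all [Formula.subst, OrFree]

theorem bounded_subst (t : Term) (ψ : Formula) (σ : ℕ → Term) :
    (bounded t ψ).subst (up (up σ)) = bounded (t.subst σ) (ψ.subst (up (up σ))) := by
  simp [bounded, Formula.subst, le, sub, Term.len, Term.ap2, Term.ap1, Term.one, Term.zero,
    Term.eps, Term.subst, Term.lift, Term.subst_subst, up, add_assoc]

theorem exBounded_subst (t : Term) (ψ : Formula) (σ : ℕ → Term) :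
    (exBounded t ψ).subst (up σ) = exBounded (t.subst σ) (ψ.subst (up (up σ))) := by
  simp only [exBounded, Formula.subst, bounded_subst]
  rfl

/-- Since `c` is placed below the binders without a lift, closedness is what keeps it fixed. -/
theorem exSucceq_subst {c : Term} (hc : c.Closed) (t : Term) (ψ : Formula) (σ : ℕ → Term) :
    (exSucceq c t ψ).subst (up (up σ)) = exSucceq c (t.subst σ) (ψ.subst (up (up σ))) := by
  simp only [exSucceq, ← bounded_subst, Formula.subst, subst_subst, succeq, Term.subst,
    hc.subst_eq, Term.zero, Term.ap1, Term.eps, scons_comp, up_comp_scons]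
  simp [up, Term.subst, Term.lift, Term.subst_subst, add_assoc]

theorem exBounded_positive {t : Term} {ψ : Formula} (h : ψ.Positive) :
    (exBounded t ψ).Positive :=
  ⟨trivial, trivial, h⟩

theorem bounded_positive {t : Term} {ψ : Formula} (h : ψ.Positive) : (bounded t ψ).Positive :=
  ⟨trivial, h⟩

theorem exSucceq_positive {c t : Term} {ψ : Formula} (h : ψ.Positive) :
    (exSucceq c t ψ).Positive :=
  ⟨trivial, trivial, (bounded_positive h).subst _⟩

/-- Substitutions agreeing on an initial segment of the variables agree on `A`. -/
theorem exists_support (A : Formula) :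
    ∃ N, ∀ σ τ : ℕ → Term, (∀ i < N, σ i = τ i) → A.subst σ = A.subst τ := by
  have term (t : Term) :
      ∃ N, ∀ σ τ : ℕ → Term, (∀ i < N, σ i = τ i) → t.subst σ = t.subst τ := by
    induction t with
    | var i => exact ⟨i + 1, fun σ τ h => h i (by omega)⟩
    | const c => exact ⟨0, fun _ _ _ => rfl⟩
    | app r t hr ht =>
      obtain ⟨M, hM⟩ := hr
      obtain ⟨N, hN⟩ := ht
      exact ⟨max M N, fun σ τ h => by
        simp only [Term.subst, hM σ τ fun i hi => h i (by omega),
          hN σ τ fun i hi => h i (by omega)]⟩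
  -- Agreement below `N` survives passing under a binder, so the bound for the body also serves the
  -- quantified formula; it need not be optimal.
  have quant {N : ℕ} {σ τ : ℕ → Term} (h : ∀ i < N, σ i = τ i) : ∀ i < N, up σ i = up τ i
    | 0, _ => rfl
    | i + 1, hi => by simp [up, h i (by omega)]
  induction A with
  | W t =>
    obtain ⟨N, hN⟩ := term t
    exact ⟨N, fun σ τ h => by simp only [Formula.subst, hN σ τ h]⟩
  | eq r t =>
    obtain ⟨M, hM⟩ := term r
    obtain ⟨N, hN⟩ := term t
    exact ⟨max M N, fun σ τ h => by
      simp only [Formula.subst, hM σ τ fun i hi => h i (by omega),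
        hN σ τ fun i hi => h i (by omega)]⟩
  | neg A hA =>
    obtain ⟨N, hN⟩ := hA
    exact ⟨N, fun σ τ h => by simp only [Formula.subst, hN σ τ h]⟩
  | and A B hA hB | or A B hA hB | imp A B hA hB =>
    obtain ⟨M, hM⟩ := hA
    obtain ⟨N, hN⟩ := hB
    exact ⟨max M N, fun σ τ h => by
      simp only [Formula.subst, hM σ τ fun i hi => h i (by omega),
        hN σ τ fun i hi => h i (by omega)]⟩
  | all A hA | ex A hA =>
    obtain ⟨N, hN⟩ := hA
    exact ⟨N, fun σ τ h => by simp only [Formula.subst, hN _ _ (quant h)]⟩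

/-- Supplies a variable fresh for a whole sequent: the bound `N` itself. -/
theorem exists_support_list (Γ : List Formula) :
    ∃ N, ∀ A ∈ Γ, ∀ σ τ : ℕ → Term, (∀ i < N, σ i = τ i) → A.subst σ = A.subst τ := by
  induction Γ with
  | nil => exact ⟨0, by simp⟩
  | cons A Γ ih =>
    obtain ⟨M, hM⟩ := A.exists_support
    obtain ⟨N, hN⟩ := ih
    refine ⟨max M N, fun B hB σ τ h => ?_⟩
    rcases List.mem_cons.1 hB with rfl | hB
    · exact hM σ τ fun i hi => h i (by omega)
    · exact hN B hB σ τ fun i hi => h i (by omega)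

end Formula

theorem liftAll_one_map (Γ : List Formula) (σ : ℕ → Term) :
    (liftAll 1 Γ).map (Formula.subst (up σ)) = liftAll 1 (Γ.map (Formula.subst σ)) := by
  simp [liftAll, lift_one_subst_up]

theorem liftAll_two_map (Γ : List Formula) (σ : ℕ → Term) :
    (liftAll 2 Γ).map (Formula.subst (up (up σ))) = liftAll 2 (Γ.map (Formula.subst σ)) := by
  simp [liftAll, lift_two_subst_up]

theorem liftAll_liftAll (Γ : List Formula) : liftAll 1 (liftAll 1 Γ) = liftAll 2 Γ := by
  simp [liftAll, lift_lift]

/-! ### Closure of derivability under substitution -/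

theorem Ax.subst {Γ Δ : List Formula} (h : Ax Γ Δ) (σ : ℕ → Term) :
    Ax (Γ.map (Formula.subst σ)) (Δ.map (Formula.subst σ)) := by
  cases h <;> constructor

theorem Ax.positive {Γ Δ : List Formula} (h : Ax Γ Δ) :
    (∀ A ∈ Γ, A.Positive) ∧ ∀ A ∈ Δ, A.Positive := by
  cases h <;> simp [Positive, sub]

namespace Derives

variable {c : Term} {C : Formula → Prop}

/-- Needed to rename a fresh free variable into an eigenvariable. Cut formulas are substituted along
with the rest, whence the closure hypothesis on `C`. -/
theorem subst (hc : c.Closed) (hC : ∀ A σ, C A → C (A.subst σ)) {Γ Δ : List Formula}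
    (h : Derives c C Γ Δ) (σ : ℕ → Term) :
    Derives c C (Γ.map (Formula.subst σ)) (Δ.map (Formula.subst σ)) := by
  induction h generalizing σ with
  | id A => exact id _
  | struct hΓ hΔ _ ih => exact struct (List.map_subset _ hΓ) (List.map_subset _ hΔ) (ih σ)
  | cut A hA _ _ ih₁ ih₂ => exact cut _ (hC A σ hA) (ih₁ σ) (ih₂ σ)
  | negL _ ih => exact negL (ih σ)
  | negR _ ih => exact negR (ih σ)
  | andL _ ih => exact andL (ih σ)
  | andR _ _ ih₁ ih₂ => exact andR (ih₁ σ) (ih₂ σ)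
  | orL _ _ ih₁ ih₂ => exact orL (ih₁ σ) (ih₂ σ)
  | orR _ ih => exact orR (ih σ)
  | impL _ _ ih₁ ih₂ => exact impL (ih₁ σ) (ih₂ σ)
  | impR _ ih => exact impR (ih σ)
  | allL t _ ih =>
    refine allL (t.subst σ) ?_
    simpa only [List.map_cons, inst_subst] using ih σ
  | exR t _ ih =>
    refine exR (t.subst σ) ?_
    simpa only [List.map_cons, inst_subst] using ih σ
  | allR _ ih =>
    refine allR ?_
    simpa only [List.map_cons, liftAll_one_map] using ih (up σ)
  | exL _ ih =>
    refine exL ?_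
    simpa only [List.map_cons, liftAll_one_map] using ih (up σ)
  | ax h => exact ax (h.subst σ)
  | notationInd t s ψ hψ hW _ _ _ _ ih₁ ih₂ ih₃ ih₄ =>
    -- Applied with `r` a binary successor of variable `0`, which `up σ` fixes.
    have shift (r : Term) (h : r.subst (up σ) = r) :
        ((exBounded t ψ).subst (scons r fun i => var (i + 1))).subst (up σ) =
        (exBounded (t.subst σ) (ψ.subst (up (up σ)))).subst
          (scons r fun i => var (i + 1)) := by
      rw [← exBounded_subst, subst_up_scons, Formula.subst_subst, scons_comp, h]
      rfl
    have h₁ := ih₁ (up σ)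
    have h₂ := ih₂ σ
    have h₃ := ih₃ (up σ)
    have h₄ := ih₄ (up σ)
    simp only [List.map_cons, liftAll_one_map, inst_subst, exBounded_subst] at h₁ h₂ h₃ h₄ ⊢
    rw [shift _ rfl] at h₃ h₄
    refine notationInd _ _ _ (hψ.subst _) (hW.subst _) ?_ h₂ h₃ h₄
    simpa [Formula.subst, Term.subst, Term.lift, Term.subst_subst, up] using h₁
  | monotoneInd t s ψ hψ hW hO _ _ _ ih₁ ih₂ ih₃ =>
    have h₁ := ih₁ (up σ)
    have h₂ := ih₂ σ
    have h₃ := ih₃ (up (up σ))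
    simp only [List.map_cons, liftAll_one_map, liftAll_two_map, inst_subst, exBounded_subst,
      bounded_subst, exSucceq_subst hc] at h₁ h₂ h₃ ⊢
    refine monotoneInd _ _ _ (hψ.subst _) (hW.subst _) (hO.subst _) ?_ h₂ h₃
    simpa [Formula.subst, Term.subst, Term.lift, Term.subst_subst, up] using h₁

/-- A sequent containing a fresh variable is derivable if all its instances are. -/
theorem of_forall_inst (hc : c.Closed) (hC : ∀ A σ, C A → C (A.subst σ))
    {Γ Δ Γ' Δ' : List Formula}
    (h : ∀ u, Derives c C (Γ'.map (·.inst u) ++ Γ) (Δ'.map (·.inst u) ++ Δ)) :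
    Derives c C (Γ' ++ liftAll 1 Γ) (Δ' ++ liftAll 1 Δ) := by
  obtain ⟨N, hN⟩ := exists_support_list (Γ ++ Δ ++ Γ' ++ Δ')
  -- The premise is used at the fresh variable `N`. Renaming by `σ` turns `N` into the eigenvariable
  -- `0` and shifts the others: it undoes the instantiation in `Γ'`, `Δ'` and acts as a lift on `Γ`,
  -- `Δ`.
  let σ : ℕ → Term := fun i => if i = N then var 0 else var (i + 1)
  have old {Θ : List Formula} (hΘ : Θ ⊆ Γ ++ Δ ++ Γ' ++ Δ') :
      Θ.map (Formula.subst σ) = liftAll 1 Θ :=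
    List.map_congr_left fun A hA => hN A (hΘ hA) _ _ fun i hi => if_neg hi.ne
  have new {Θ : List Formula} (hΘ : Θ ⊆ Γ ++ Δ ++ Γ' ++ Δ') :
      (Θ.map (·.inst (var N))).map (Formula.subst σ) = Θ := by
    rw [List.map_map]
    refine (List.map_congr_left fun A hA => ?_).trans (List.map_id _)
    rw [Function.comp_apply, Formula.inst, Formula.subst_subst, id_eq]
    refine (hN A (hΘ hA) _ var fun i hi => ?_).trans A.subst_var
    cases i with
    | zero => simp [σ, Term.subst]
    | succ i => simpa [σ, Term.subst] using fun h => absurd h (by omega)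
  have := (h (var N)).subst hc hC σ
  rwa [List.map_append, List.map_append, new, new, old, old] at this <;>
    (intro A hA; simp [hA])

theorem of_forall_inst_two (hc : c.Closed) (hC : ∀ A σ, C A → C (A.subst σ))
    {Γ Δ Γ' Δ' : List Formula}
    (h : ∀ a b, Derives c C (Γ'.map (Formula.subst (scons b (scons a var))) ++ Γ)
      (Δ'.map (Formula.subst (scons b (scons a var))) ++ Δ)) :
    Derives c C (Γ' ++ liftAll 2 Γ) (Δ' ++ liftAll 2 Δ) := by
  rw [← liftAll_liftAll, ← liftAll_liftAll]
  refine of_forall_inst hc hC fun u => of_forall_inst hc hC fun v => ?_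
  -- The term `u` chosen for `b` may still contain the variable standing for `a`, so the later
  -- choice of `v` for `a` acts on `u` too.
  have inst_inst (A : Formula) :
      (A.inst u).inst v = A.subst (scons (u.subst (scons v var)) (scons v var)) := by
    simp only [Formula.inst, Formula.subst_subst, scons_comp]
    rfl
  simpa [Function.comp_def, inst_inst] using h v (u.subst (scons v var))

end Derives

/-! ### Saturated pairs of sets of formulas -/

/-- The closure conditions imposed on a saturated pair. -/
inductive Task : Type
  | decide (A : Formula)
  | left (A : Formula) (t : Term)
  | right (A : Formula) (t : Term)
  | notationInd (t s : Term) (ψ : Formula)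
  | monotoneInd (t s : Term) (ψ : Formula)

namespace Task

/-- The hypothesis of a closure condition on the pair `(L, R)`. -/
def Trigger : Task → Set Formula → Set Formula → Prop
  | decide A, _, _ => A.Positive
  | left A _, L, _ => A ∈ L
  | right A _, _, R => A ∈ R
  | notationInd t s ψ, L, R =>
    (ψ.Positive ∧ ψ.WFree) ∧ W s ∈ L ∧ (exBounded t ψ).inst s ∈ R
  | monotoneInd t s ψ, L, R =>
    (ψ.Positive ∧ ψ.WFree ∧ ψ.OrFree) ∧ W s ∈ L ∧ (exBounded t ψ).inst s ∈ R

/-- The conclusion of a closure condition on the pair `(L, R)`, which `c` enters through `⪰`. -/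
def Goal (c : Term) : Task → Set Formula → Set Formula → Prop
  | decide A, L, R => A ∈ L ∨ A ∈ R
  | left (Formula.W _) _, _, _ => True
  | left (Formula.eq _ _) _, _, _ => True
  | left (Formula.neg A) _, _, R => A ∈ R
  | left (Formula.and A B) _, L, _ => A ∈ L ∧ B ∈ L
  | left (Formula.or A B) _, L, _ => A ∈ L ∨ B ∈ L
  | left (Formula.imp A B) _, L, R => A ∈ R ∨ B ∈ L
  | left (Formula.all A) t, L, _ => A.inst t ∈ L
  | left (Formula.ex A) _, L, _ => ∃ u, A.inst u ∈ L
  | right (Formula.W _) _, _, _ => True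
  | right (Formula.eq _ _) _, _, _ => True
  | right (Formula.neg A) _, L, _ => A ∈ L
  | right (Formula.and A B) _, _, R => A ∈ R ∨ B ∈ R
  | right (Formula.or A B) _, _, R => A ∈ R ∧ B ∈ R
  | right (Formula.imp A B) _, L, R => A ∈ L ∧ B ∈ R
  | right (Formula.all A) _, _, R => ∃ u, A.inst u ∈ R
  | right (Formula.ex A) t, _, R => A.inst t ∈ R
  | notationInd t _ ψ, L, R =>
    (∃ u, W u ∈ L ∧ W (app t u) ∈ R) ∨ (exBounded t ψ).inst eps ∈ R ∨
      ∃ a, W a ∈ L ∧ (exBounded t ψ).inst a ∈ L ∧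
        ((exBounded t ψ).inst (ap1 Const.s0 a) ∈ R ∨ (exBounded t ψ).inst (ap1 Const.s1 a) ∈ R)
  | monotoneInd t _ ψ, L, R =>
    (∃ u, W u ∈ L ∧ W (app t u) ∈ R) ∨ (exBounded t ψ).inst eps ∈ R ∨
      ∃ a b, W a ∈ L ∧ W b ∈ L ∧ (bounded t ψ).subst (scons b (scons a var)) ∈ L ∧
        (exSucceq c t ψ).subst (scons b (scons a var)) ∈ R

/-- Membership in `L` and `R` occurs only positively in hypotheses and conclusions, so both persist
from a finite stage to all extensions and to the limit. -/
theorem Trigger.mono {T : Task} {L L' R R' : Set Formula} (h : T.Trigger L R)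
    (hL : L ⊆ L') (hR : R ⊆ R') : T.Trigger L' R' := by
  cases T with
  | decide A => exact h
  | left A t => exact hL h
  | right A t => exact hR h
  | notationInd t s ψ => exact ⟨h.1, hL h.2.1, hR h.2.2⟩
  | monotoneInd t s ψ => exact ⟨h.1, hL h.2.1, hR h.2.2⟩

theorem Goal.mono {c : Term} {T : Task} {L L' R R' : Set Formula} (h : T.Goal c L R)
    (hL : L ⊆ L') (hR : R ⊆ R') : T.Goal c L' R' := by
  cases T with
  | decide A => exact h.imp (@hL _) (@hR _)
  | left A t =>
    cases A with
    | W | eq => trivial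
    | neg A => exact hR h
    | and A B => exact ⟨hL h.1, hL h.2⟩
    | or A B => exact h.imp (@hL _) (@hL _)
    | imp A B => exact h.imp (@hR _) (@hL _)
    | all A => exact hL h
    | ex A => exact h.imp fun _ => @hL _
  | right A t =>
    cases A with
    | W | eq => trivial
    | neg A => exact hL h
    | and A B => exact h.imp (@hR _) (@hR _)
    | or A B => exact ⟨hR h.1, hR h.2⟩
    | imp A B => exact ⟨hL h.1, hR h.2⟩
    | all A => exact h.imp fun _ => @hR _
    | ex A => exact hR h
  | notationInd t s ψ =>
    rcases h with ⟨u, h₁, h₂⟩ | h | ⟨a, h₁, h₂, h₃⟩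
    · exact Or.inl ⟨u, hL h₁, hR h₂⟩
    · exact Or.inr (Or.inl (hR h))
    · exact Or.inr (Or.inr ⟨a, hL h₁, hL h₂, h₃.imp (@hR _) (@hR _)⟩)
  | monotoneInd t s ψ =>
    rcases h with ⟨u, h₁, h₂⟩ | h | ⟨a, b, h₁, h₂, h₃, h₄⟩
    · exact Or.inl ⟨u, hL h₁, hR h₂⟩
    · exact Or.inr (Or.inl (hR h))
    · exact Or.inr (Or.inr ⟨a, b, hL h₁, hL h₂, hL h₃, hR h₄⟩)

end Task

/-- The set of members of a list of formulas. -/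
def members (Γ : List Formula) : Set Formula := {A | A ∈ Γ}

@[simp] theorem mem_members {A : Formula} {Γ : List Formula} : A ∈ members Γ ↔ A ∈ Γ := Iff.rfl

/-- A sequent to which a closure condition applies is derivable if all its extensions that
satisfy the closure condition are. -/
theorem Task.derives {c : Term} (hc : c.Closed) (T : Task) {Γ Δ : List Formula}
    (hT : T.Trigger (members Γ) (members Δ))
    (h : ∀ Γ' Δ', T.Goal c (members (Γ' ++ Γ)) (members (Δ' ++ Δ)) →
      ProvablePosCut c (Γ' ++ Γ) (Δ' ++ Δ)) :
    ProvablePosCut c Γ Δ := by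
  -- Extensions keep the principal formula; contraction absorbs the extra copy introduced by the
  -- rule.
  have left {A : Formula} (hA : A ∈ Γ) (d : ProvablePosCut c (A :: Γ) Δ) :
      ProvablePosCut c Γ Δ :=
    Derives.struct (List.cons_subset.2 ⟨hA, List.Subset.refl _⟩) (List.Subset.refl _) d
  have right {A : Formula} (hA : A ∈ Δ) (d : ProvablePosCut c Γ (A :: Δ)) :
      ProvablePosCut c Γ Δ :=
    Derives.struct (List.Subset.refl _) (List.cons_subset.2 ⟨hA, List.Subset.refl _⟩) d
  have hC : ∀ A σ, Formula.Positive A → Formula.Positive (A.subst σ) := fun _ σ h => h.subst σ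
  have both {A B : Formula} (hA : A ∈ Γ) (hB : B ∈ Δ)
      (d : ProvablePosCut c (A :: Γ) (B :: Δ)) : ProvablePosCut c Γ Δ :=
    Derives.struct (List.cons_subset.2 ⟨hA, List.Subset.refl _⟩)
      (List.cons_subset.2 ⟨hB, List.Subset.refl _⟩) d
  have total (t : Term)
      (d : ∀ u, W u ∈ members ([W u] ++ Γ) ∧ W (app t u) ∈ members ([W (app t u)] ++ Δ) →
        ProvablePosCut c ([W u] ++ Γ) ([W (app t u)] ++ Δ)) :
      ProvablePosCut c (W (var 0) :: liftAll 1 Γ)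
        (W (app (t.lift 1) (var 0)) :: liftAll 1 Δ) := by
    refine Derives.of_forall_inst (Γ' := [W (var 0)]) (Δ' := [_]) hc hC fun u => ?_
    simpa [Formula.inst, Formula.subst, Term.subst, Term.lift, Term.subst_subst,
      Term.subst_var, ProvablePosCut] using d u (by simp)
  have step (A : Formula) (r a : Term) :
      (A.subst (scons r fun i => var (i + 1))).inst a = A.inst (r.subst (scons a var)) := by
    simp only [Formula.inst, Formula.subst_subst, scons_comp]
    rfl
  cases T with
  | decide A =>
    -- The only new cut in the whole construction, and its formula is positive.
    exact Derives.cut A hT (h [] [A] (by simp [Goal])) (h [A] [] (by simp [Goal]))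
  | left A t =>
    refine left hT ?_
    cases A with
    | W | eq =>
      exact Derives.struct (List.subset_cons_self _ _) (List.Subset.refl _) (h [] [] trivial)
    | neg A => exact Derives.negL (h [] [A] (by simp [Goal]))
    | and A B => exact Derives.andL (h [A, B] [] (by simp [Goal]))
    | or A B => exact Derives.orL (h [A] [] (by simp [Goal])) (h [B] [] (by simp [Goal]))
    | imp A B => exact Derives.impL (h [] [A] (by simp [Goal])) (h [B] [] (by simp [Goal]))
    | all A => exact Derives.allL t (h [A.inst t] [] (by simp [Goal]))
    | ex A =>
      exact Derives.exL (Derives.of_forall_inst (Γ' := [A]) (Δ' := []) hc hC fun u =>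
        h [A.inst u] [] ⟨u, by simp⟩)
  | right A t =>
    refine right hT ?_
    cases A with
    | W | eq =>
      exact Derives.struct (List.Subset.refl _) (List.subset_cons_self _ _) (h [] [] trivial)
    | neg A => exact Derives.negR (h [A] [] (by simp [Goal]))
    | and A B => exact Derives.andR (h [] [A] (by simp [Goal])) (h [] [B] (by simp [Goal]))
    | or A B => exact Derives.orR (h [] [A, B] (by simp [Goal]))
    | imp A B => exact Derives.impR (h [A] [B] (by simp [Goal]))
    | all A =>
      exact Derives.allR (Derives.of_forall_inst (Γ' := []) (Δ' := [A]) hc hC fun u =>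
        h [] [A.inst u] ⟨u, by simp⟩)
    | ex A => exact Derives.exR t (h [] [A.inst t] (by simp [Goal]))
  | notationInd t s ψ =>
    obtain ⟨⟨hψ, hW⟩, hs, hφ⟩ := hT
    -- The alternatives in the goal are the ways a premise of the rule can fail, with eigenvariables
    -- replaced by terms; each premise follows from its instances.
    refine both hs hφ (Derives.notationInd t s ψ hψ hW (total t fun u hu => ?_)
      (h [] [_] (Or.inr (Or.inl (by simp)))) ?_ ?_)
    · exact h [W u] [W (app t u)] (Or.inl ⟨u, hu⟩)
    · refine Derives.of_forall_inst (Γ' := [W (var 0), exBounded t ψ]) (Δ' := [_]) hc hC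
        fun a => ?_
      have := h [W a, (exBounded t ψ).inst a] [(exBounded t ψ).inst (ap1 Const.s0 a)]
        (Or.inr (Or.inr ⟨a, by simp⟩))
      rwa [List.map_cons, List.map_cons, List.map_nil, List.map_cons, List.map_nil, step]
    · refine Derives.of_forall_inst (Γ' := [W (var 0), exBounded t ψ]) (Δ' := [_]) hc hC
        fun a => ?_
      have := h [W a, (exBounded t ψ).inst a] [(exBounded t ψ).inst (ap1 Const.s1 a)]
        (Or.inr (Or.inr ⟨a, by simp⟩))
      rwa [List.map_cons, List.map_cons, List.map_nil, List.map_cons, List.map_nil, step]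
  | monotoneInd t s ψ =>
    obtain ⟨⟨hψ, hW, hO⟩, hs, hφ⟩ := hT
    refine both hs hφ (Derives.monotoneInd t s ψ hψ hW hO (total t fun u hu => ?_)
      (h [] [_] (Or.inr (Or.inl (by simp)))) ?_)
    · exact h [W u] [W (app t u)] (Or.inl ⟨u, hu⟩)
    · exact Derives.of_forall_inst_two (Γ' := [W (var 1), W (var 0), bounded t ψ])
        (Δ' := [_]) hc hC fun a b => h [W a, W b, _] [_]
          (Or.inr (Or.inr ⟨a, b, by simp⟩))

/-! ### Existence of saturated pairs -/

/-- Injective coding of constants. -/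
def Const.code : Const → ℕ
  | k => 0 | s => 1 | p => 2 | p0 => 3 | p1 => 4 | cW => 5 | eps => 6 | s0 => 7 | s1 => 8
  | pW => 9 | sl => 10 | pl => 11 | csub => 12 | cat => 13 | times => 14

theorem Const.code_injective : Function.Injective Const.code := by
  intro a b h
  cases a <;> cases b <;> first | rfl | exact absurd h (by decide)

/-- Injective coding of terms. -/
def Term.code : Term → ℕ
  | var i => Nat.pair 0 i
  | const c => Nat.pair 1 c.code
  | app r t => Nat.pair 2 (Nat.pair r.code t.code)

theorem Term.code_injective : Function.Injective Term.code := by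
  intro r
  induction r with
  | var i => intro t h; cases t <;> simp_all [code]
  | const c =>
    intro t h
    cases t <;> simp_all [code, Const.code_injective.eq_iff]
  | app r r' ih ih' =>
    intro t h
    cases t <;> simp [code] at h
    rw [ih h.1, ih' h.2]

/-- Injective coding of formulas. -/
def Formula.code : Formula → ℕ
  | W t => Nat.pair 0 t.code
  | eq r t => Nat.pair 1 (Nat.pair r.code t.code)
  | neg A => Nat.pair 2 A.code
  | and A B => Nat.pair 3 (Nat.pair A.code B.code)
  | or A B => Nat.pair 4 (Nat.pair A.code B.code)
  | imp A B => Nat.pair 5 (Nat.pair A.code B.code)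
  | all A => Nat.pair 6 A.code
  | ex A => Nat.pair 7 A.code

theorem Formula.code_injective : Function.Injective Formula.code := by
  intro A
  induction A with
  | W | eq => intro B h; cases B <;> simp_all [code, Term.code_injective.eq_iff]
  | neg A ih | all A ih | ex A ih =>
    intro B h
    cases B <;> simp [code] at h
    rw [ih h]
  | and A A' ih ih' | or A A' ih ih' | imp A A' ih ih' =>
    intro B h
    cases B <;> simp [code] at h
    rw [ih h.1, ih' h.2]

/-- Injective coding of tasks. -/
def Task.code : Task → ℕ
  | decide A => Nat.pair 0 A.code
  | left A t => Nat.pair 1 (Nat.pair A.code t.code)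
  | right A t => Nat.pair 2 (Nat.pair A.code t.code)
  | notationInd t s ψ => Nat.pair 3 (Nat.pair t.code (Nat.pair s.code ψ.code))
  | monotoneInd t s ψ => Nat.pair 4 (Nat.pair t.code (Nat.pair s.code ψ.code))

theorem Task.code_injective : Function.Injective Task.code := by
  intro T T' h
  cases T <;> cases T' <;>
    simp_all [code, Term.code_injective.eq_iff, Formula.code_injective.eq_iff]

/-- Countability allows one ideal to meet all closure conditions. -/
instance : Countable Task := Task.code_injective.countable

/-- A pair `(L, R)` of sets of formulas that contains no sequent derivable with positive cuts and
satisfies all closure conditions. -/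
structure Saturated (c : Term) (L R : Set Formula) : Prop where
  consistent {Γ Δ : List Formula} :
    (∀ A ∈ Γ, A ∈ L) → (∀ A ∈ Δ, A ∈ R) → ¬ ProvablePosCut c Γ Δ
  closed {T : Task} : T.Trigger L R → T.Goal c L R

/-- The sequents that are not derivable with positive cuts. -/
def Unprovable (c : Term) : Type := {S : List Formula × List Formula // ¬ ProvablePosCut c S.1 S.2}

/-! ### Generic extension of an unprovable sequent -/

namespace Unprovable

variable {c : Term}

/-- Not antisymmetric: lists may differ in order and multiplicity alone. -/
instance : Preorder (Unprovable c) where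
  le S S' := S.1.1 ⊆ S'.1.1 ∧ S.1.2 ⊆ S'.1.2
  le_refl S := ⟨List.Subset.refl _, List.Subset.refl _⟩
  le_trans _ _ _ h h' := ⟨List.Subset.trans h.1 h'.1, List.Subset.trans h.2 h'.2⟩

/-- The antecedent as a set. -/
def left (S : Unprovable c) : Set Formula := members S.1.1

/-- The succedent as a set. -/
def right (S : Unprovable c) : Set Formula := members S.1.2

theorem left_mono {S S' : Unprovable c} (h : S ≤ S') : S.left ⊆ S'.left := fun _ hA => h.1 hA

theorem right_mono {S S' : Unprovable c} (h : S ≤ S') : S.right ⊆ S'.right := fun _ hA => h.2 hA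

/-- The sequents that decide the closure condition `T`. -/
def deciding (hc : c.Closed) (T : Task) : Order.Cofinal (Unprovable c) where
  -- The second alternative makes the set cofinal even where the hypothesis of `T` can never arise.
  carrier := {S | T.Goal c S.left S.right ∨ ∀ S' ≥ S, ¬ T.Trigger S'.left S'.right}
  isCofinal S := by
    by_cases h : ∃ S' ≥ S, T.Trigger S'.left S'.right
    · obtain ⟨S', hS, hT⟩ := h
      by_contra! hg
      -- If every extension of `S'` meeting the goal were provable, `S'` would be provable as well.
      refine S'.2 (T.derives hc hT fun Γ Δ hG => ?_)
      by_contra hd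
      exact hg ⟨(Γ ++ S'.1.1, Δ ++ S'.1.2), hd⟩ (Or.inl hG)
        (hS.trans ⟨List.subset_append_right _ _, List.subset_append_right _ _⟩)
    · push Not at h
      exact ⟨S, Or.inr h, le_rfl⟩

/-- Rasiowa–Sikorski: `L` and `R` are the unions over an ideal through `S` meeting every `deciding
hc T`. By directedness, a finite part of the union lies in a single unprovable sequent, which gives
consistency. -/
theorem exists_saturated (hc : c.Closed) (S : Unprovable c) :
    ∃ L R, Saturated c L R ∧ S.left ⊆ L ∧ S.right ⊆ R := by
  have := Encodable.ofCountable Task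
  let I := Order.idealOfCofinals S (deciding hc)
  let L : Set Formula := {A | ∃ X ∈ I, A ∈ X.left}
  let R : Set Formula := {A | ∃ X ∈ I, A ∈ X.right}
  have hL {X : Unprovable c} (hX : X ∈ I) : X.left ⊆ L := fun _ hA => ⟨X, hX, hA⟩
  have hR {X : Unprovable c} (hX : X ∈ I) : X.right ⊆ R := fun _ hA => ⟨X, hX, hA⟩
  have coverL (Γ : List Formula) (h : ∀ A ∈ Γ, A ∈ L) : ∃ X ∈ I, members Γ ⊆ X.left := by
    induction Γ with
    | nil => exact ⟨S, Order.mem_idealOfCofinals _ _, by simp [members]⟩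
    | cons A Γ ih =>
      obtain ⟨X, hX, hXΓ⟩ := ih fun B hB => h B (List.mem_cons_of_mem _ hB)
      obtain ⟨Y, hY, hYA⟩ := h A List.mem_cons_self
      obtain ⟨Z, hZ, hXZ, hYZ⟩ := I.directed X hX Y hY
      refine ⟨Z, hZ, fun B hB => ?_⟩
      rcases List.mem_cons.1 hB with rfl | hB
      · exact left_mono hYZ hYA
      · exact left_mono hXZ (hXΓ hB)
  have coverR (Γ : List Formula) (h : ∀ A ∈ Γ, A ∈ R) : ∃ X ∈ I, members Γ ⊆ X.right := by
    induction Γ with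
    | nil => exact ⟨S, Order.mem_idealOfCofinals _ _, by simp [members]⟩
    | cons A Γ ih =>
      obtain ⟨X, hX, hXΓ⟩ := ih fun B hB => h B (List.mem_cons_of_mem _ hB)
      obtain ⟨Y, hY, hYA⟩ := h A List.mem_cons_self
      obtain ⟨Z, hZ, hXZ, hYZ⟩ := I.directed X hX Y hY
      refine ⟨Z, hZ, fun B hB => ?_⟩
      rcases List.mem_cons.1 hB with rfl | hB
      · exact right_mono hYZ hYA
      · exact right_mono hXZ (hXΓ hB)
  have cover (Γ Δ : List Formula) (hΓ : ∀ A ∈ Γ, A ∈ L) (hΔ : ∀ A ∈ Δ, A ∈ R) :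
      ∃ X ∈ I, members Γ ⊆ X.left ∧ members Δ ⊆ X.right := by
    obtain ⟨X, hX, hXΓ⟩ := coverL Γ hΓ
    obtain ⟨Y, hY, hYΔ⟩ := coverR Δ hΔ
    obtain ⟨Z, hZ, hXZ, hYZ⟩ := I.directed X hX Y hY
    exact ⟨Z, hZ, hXΓ.trans (left_mono hXZ), hYΔ.trans (right_mono hYZ)⟩
  refine ⟨L, R, ⟨fun {Γ Δ} hΓ hΔ hd => ?_, fun {T} hT => ?_⟩,
    hL (Order.mem_idealOfCofinals _ _), hR (Order.mem_idealOfCofinals _ _)⟩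
  · obtain ⟨X, -, hXΓ, hXΔ⟩ := cover Γ Δ hΓ hΔ
    exact X.2 (Derives.struct (fun _ hA => hXΓ hA) (fun _ hA => hXΔ hA) hd)
  · obtain ⟨X, hXD, hX⟩ := Order.cofinal_meets_idealOfCofinals S (deciding hc) T
    -- A hypothesis mentions finitely many formulas, so it already holds at some member of the
    -- ideal. A common extension with the deciding member `X` then rules out the alternative that
    -- `T` is never triggered above `X`.
    have trigger : ∃ Y ∈ I, T.Trigger Y.left Y.right := by
      cases T with
      | decide A => exact ⟨X, hX, hT⟩
      | left A t =>
        obtain ⟨Y, hY, h⟩ := hT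
        exact ⟨Y, hY, h⟩
      | right A t =>
        obtain ⟨Y, hY, h⟩ := hT
        exact ⟨Y, hY, h⟩
      | notationInd t s ψ | monotoneInd t s ψ =>
        obtain ⟨Y, hY, hl, hr⟩ := cover [W s] [(exBounded t ψ).inst s]
          (by simpa using hT.2.1) (by simpa using hT.2.2)
        exact ⟨Y, hY, hT.1, hl (by simp), hr (by simp)⟩
    obtain ⟨Y, hY, hTY⟩ := trigger
    obtain ⟨Z, hZ, hXZ, hYZ⟩ := I.directed X hX Y hY
    rcases hXD with hg | hn
    · exact hg.mono (hL hX) (hR hX)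
    · exact absurd (hTY.mono (left_mono hYZ) (right_mono hYZ)) (hn Z hXZ)

end Unprovable

/-! ### The term model of a saturated pair -/

/-- Truth in the term model whose true atoms are those in `L`. -/
def Sat (L : Set Formula) : (ℕ → Term) → Formula → Prop
  | σ, Formula.W t => W (t.subst σ) ∈ L
  | σ, Formula.eq r t => eq (r.subst σ) (t.subst σ) ∈ L
  | σ, Formula.neg A => ¬ Sat L σ A
  | σ, Formula.and A B => Sat L σ A ∧ Sat L σ B
  | σ, Formula.or A B => Sat L σ A ∨ Sat L σ B
  | σ, Formula.imp A B => Sat L σ A → Sat L σ B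
  | σ, Formula.all A => ∀ u, Sat L (scons u σ) A
  | σ, Formula.ex A => ∃ u, Sat L (scons u σ) A

/-! ### Substitution and lifting in the term model -/

theorem sat_subst {L : Set Formula} (A : Formula) (σ τ : ℕ → Term) :
    Sat L τ (A.subst σ) ↔ Sat L (fun i => (σ i).subst τ) A := by
  induction A generalizing σ τ <;>
    simp_all [Sat, Formula.subst, Term.subst_subst, up_comp_scons]

theorem subst_up_up_scons (A : Formula) (r t : Term) (σ : ℕ → Term) :
    (A.subst (up (up σ))).subst (scons r (scons t var)) = A.subst (scons r (scons t σ)) := by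
  simp [subst_up_scons, up_comp_scons, Term.subst_var]

theorem sat_inst {L : Set Formula} (A : Formula) (t : Term) (σ : ℕ → Term) :
    Sat L σ (A.inst t) ↔ Sat L (scons (t.subst σ) σ) A := by
  rw [Formula.inst, sat_subst, scons_comp]
  rfl

theorem sat_lift_one {L : Set Formula} (A : Formula) (t : Term) (σ : ℕ → Term) :
    Sat L (scons t σ) (A.lift 1) ↔ Sat L σ A := by
  rw [Formula.lift, sat_subst]
  rfl

theorem sat_lift_two {L : Set Formula} (A : Formula) (r t : Term) (σ : ℕ → Term) :
    Sat L (scons r (scons t σ)) (A.lift 2) ↔ Sat L σ A := by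
  rw [← lift_lift, sat_lift_one, sat_lift_one]

theorem forall_sat_liftAll_one {L : Set Formula} {Γ : List Formula} {t : Term}
    {σ : ℕ → Term} :
    (∀ A ∈ liftAll 1 Γ, Sat L (scons t σ) A) ↔ ∀ A ∈ Γ, Sat L σ A := by
  simp [liftAll, sat_lift_one]

theorem exists_sat_liftAll_one {L : Set Formula} {Γ : List Formula} {t : Term}
    {σ : ℕ → Term} :
    (∃ A ∈ liftAll 1 Γ, Sat L (scons t σ) A) ↔ ∃ A ∈ Γ, Sat L σ A := by
  simp [liftAll, sat_lift_one]

theorem forall_sat_liftAll_two {L : Set Formula} {Γ : List Formula} {r t : Term}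
    {σ : ℕ → Term} :
    (∀ A ∈ liftAll 2 Γ, Sat L (scons r (scons t σ)) A) ↔ ∀ A ∈ Γ, Sat L σ A := by
  simp [liftAll, sat_lift_two]

theorem exists_sat_liftAll_two {L : Set Formula} {Γ : List Formula} {r t : Term}
    {σ : ℕ → Term} :
    (∃ A ∈ liftAll 2 Γ, Sat L (scons r (scons t σ)) A) ↔ ∃ A ∈ Γ, Sat L σ A := by
  simp [liftAll, sat_lift_two]

/-! ### Truth lemma and soundness -/

namespace Saturated

variable {c : Term} {L R : Set Formula}

theorem notMem_right (h : Saturated c L R) {A : Formula} (hL : A ∈ L) : A ∉ R := fun hR =>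
  h.consistent (Γ := [A]) (Δ := [A]) (by simpa) (by simpa) (Derives.id A)

/-- Hintikka's argument: the closure conditions descend to immediate subformulas, and quantifiers
range over exactly the terms. Formulas in neither set remain unconstrained, so no converse holds in
general. Equality is a mere relation here; no quotient is taken. -/
theorem truth (h : Saturated c L R) (A : Formula) (σ : ℕ → Term) :
    (A.subst σ ∈ L → Sat L σ A) ∧ (A.subst σ ∈ R → ¬ Sat L σ A) := by
  have hl {B : Formula} (hB : B ∈ L) (t : Term) : (Task.left B t).Goal c L R := h.closed hB
  have hr {B : Formula} (hB : B ∈ R) (t : Term) : (Task.right B t).Goal c L R := h.closed hB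
  induction A generalizing σ with
  | W | eq => exact ⟨fun hL => hL, fun hR hL => h.notMem_right hL hR⟩
  | neg A ih =>
    -- The term argument matters only for `all` on the left and `ex` on the right; elsewhere `eps`
    -- is a dummy.
    exact ⟨fun hA => (ih σ).2 (hl hA eps), fun hA hn => hn ((ih σ).1 (hr hA eps))⟩
  | and A B ihA ihB =>
    exact ⟨fun hA => (hl hA eps).imp (ihA σ).1 (ihB σ).1, fun hA hn =>
      (hr hA eps).elim (fun h => (ihA σ).2 h hn.1) fun h => (ihB σ).2 h hn.2⟩
  | or A B ihA ihB =>
    exact ⟨fun hA => (hl hA eps).imp (ihA σ).1 (ihB σ).1, fun hA hn =>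
      hn.elim ((ihA σ).2 (hr hA eps).1) ((ihB σ).2 (hr hA eps).2)⟩
  | imp A B ihA ihB =>
    exact ⟨fun hA hs => (hl hA eps).elim (fun h => absurd hs ((ihA σ).2 h)) (ihB σ).1,
      fun hA hn => (ihB σ).2 (hr hA eps).2 (hn ((ihA σ).1 (hr hA eps).1))⟩
  | all A ih =>
    refine ⟨fun hA u => (ih _).1 ?_, fun hA hn => ?_⟩
    · rw [← inst_subst_up]; exact hl hA u
    · obtain ⟨u, hu⟩ := hr hA eps
      rw [inst_subst_up] at hu
      exact (ih _).2 hu (hn u)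
  | ex A ih =>
    refine ⟨fun hA => ?_, fun hA ⟨u, hu⟩ => (ih _).2 ?_ hu⟩
    · obtain ⟨u, hu⟩ := hl hA eps
      rw [inst_subst_up] at hu
      exact ⟨u, (ih _).1 hu⟩
    · rw [← inst_subst_up]; exact hr hA u

theorem mem_right (h : Saturated c L R) {A : Formula} (hA : A.Positive) (hL : A ∉ L) : A ∈ R :=
  (h.closed (T := .decide A) hA).resolve_left hL

/-- Positive formulas are decided: one outside `L` lies in `R` and is therefore false. -/
theorem sat_iff (h : Saturated c L R) {A : Formula} (hA : A.Positive) (σ : ℕ → Term) :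
    Sat L σ A ↔ A.subst σ ∈ L := by
  refine ⟨fun hs => ?_, (h.truth A σ).1⟩
  by_contra hL
  exact (h.truth A σ).2 (h.mem_right (hA.subst σ) hL) hs

/-- Translates between the closure conditions for induction and truth; this is where positivity of
the induction formula enters. -/
theorem sat_exBounded (h : Saturated c L R) {t : Term} {ψ : Formula} (hψ : ψ.Positive)
    (σ : ℕ → Term) (u : Term) :
    (exBounded (t.subst σ) (ψ.subst (up (up σ)))).inst u ∈ R ↔
      ¬ Sat L (scons u σ) (exBounded t ψ) := by
  have hφ := exBounded_positive (t := t) hψ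
  rw [← exBounded_subst, inst_subst_up]
  exact ⟨(h.truth _ _).2, fun hn => h.mem_right (hφ.subst _) (mt (h.sat_iff hφ _).2 hn)⟩

theorem not_sat_app_lift (h : Saturated c L R) (t : Term) (σ : ℕ → Term) (u : Term)
    (hR : W (app (t.subst σ) u) ∈ R) :
    ¬ Sat L (scons u σ) (W (app (t.lift 1) (var 0))) := by
  refine (h.truth _ _).2 ?_
  simpa [Formula.subst, Term.subst, Term.lift, Term.subst_subst] using hR

/-- The term model of a saturated pair satisfies all sequents derivable with arbitrary cuts. -/
theorem sound (h : Saturated c L R) (hc : c.Closed) {Γ Δ : List Formula} (hd : Provable c Γ Δ)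
    (σ : ℕ → Term) (hΓ : ∀ A ∈ Γ, Sat L σ A) : ∃ A ∈ Δ, Sat L σ A := by
  induction hd generalizing σ with
  | id A => simpa using hΓ
  | struct hsΓ hsΔ _ ih =>
    obtain ⟨A, hA, hs⟩ := ih σ fun A hA => hΓ A (hsΓ hA)
    exact ⟨A, hsΔ hA, hs⟩
  | cut A _ _ _ ih₁ ih₂ =>
    have h₁ := ih₁ σ hΓ
    have h₂ := ih₂ σ
    simp only [List.forall_mem_cons, List.exists_mem_cons_iff] at h₁ h₂
    -- Soundness of cut is transitivity of truth, whatever the cut formula.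
    exact h₁.elim (fun hA => h₂ ⟨hA, hΓ⟩) fun hΔ => hΔ
  | negL _ ih | negR _ ih | andL _ ih | orR _ ih | impR _ ih =>
    have h₁ := ih σ
    simp only [List.forall_mem_cons, List.exists_mem_cons_iff, Sat] at h₁ hΓ ⊢
    tauto
  | andR _ _ ih₁ ih₂ | orL _ _ ih₁ ih₂ | impL _ _ ih₁ ih₂ =>
    have h₁ := ih₁ σ
    have h₂ := ih₂ σ
    simp only [List.forall_mem_cons, List.exists_mem_cons_iff, Sat] at h₁ h₂ hΓ ⊢
    tauto
  | allL t _ ih =>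
    have h₁ := ih σ
    simp only [List.forall_mem_cons, Sat, sat_inst] at h₁ hΓ
    exact h₁ ⟨hΓ.1 _, hΓ.2⟩
  | exR t _ ih =>
    have h₁ := ih σ hΓ
    simp only [List.exists_mem_cons_iff, Sat, sat_inst] at h₁ ⊢
    exact h₁.imp_left fun hs => ⟨_, hs⟩
  | @allR Γ Δ A _ ih =>
    have h₁ u := ih (scons u σ)
    simp only [List.exists_mem_cons_iff, Sat, forall_sat_liftAll_one,
      exists_sat_liftAll_one] at h₁ ⊢
    by_contra! hn
    obtain ⟨⟨u, hu⟩, hΔ⟩ := hn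
    exact (h₁ u hΓ).elim hu fun ⟨B, hB, hs⟩ => hΔ B hB hs
  | exL _ ih =>
    have h₁ u := ih (scons u σ)
    simp only [List.forall_mem_cons, Sat, forall_sat_liftAll_one,
      exists_sat_liftAll_one] at h₁ hΓ
    obtain ⟨⟨u, hu⟩, hΓ⟩ := hΓ
    exact h₁ u ⟨hu, hΓ⟩
  | @ax Γ Δ hax =>
    by_contra! hn
    -- A failing axiom, being positive, would have its instance spread over `L` and `R`, although
    -- that instance is derivable.
    refine h.consistent (Γ := Γ.map (Formula.subst σ)) (Δ := Δ.map (Formula.subst σ)) ?_ ?_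
      (Derives.ax (hax.subst σ))
    · simpa using fun A hA => (h.sat_iff (hax.positive.1 A hA) σ).1 (hΓ A hA)
    · simpa using fun A hA => h.mem_right ((hax.positive.2 A hA).subst σ) fun hL =>
        hn A hA ((h.sat_iff (hax.positive.2 A hA) σ).2 hL)
  | notationInd t s ψ hψ hW _ _ _ _ ih₁ ih₂ ih₃ ih₄ =>
    have h₁ u := ih₁ (scons u σ)
    have h₂ := ih₂ σ
    have h₃ u := ih₃ (scons u σ)
    have h₄ u := ih₄ (scons u σ)
    simp only [List.forall_mem_cons, List.exists_mem_cons_iff, forall_sat_liftAll_one,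
      exists_sat_liftAll_one, sat_inst, sat_subst, scons_comp] at h₁ h₂ h₃ h₄ hΓ ⊢
    obtain ⟨hs, hΓ⟩ := hΓ
    by_contra hn
    obtain ⟨hφ, hΔ⟩ := not_or.1 hn
    have sat_φ := h.sat_exBounded (t := t) hψ σ
    have sat_t := h.not_sat_app_lift t σ
    -- Falsity of the conclusion triggers the closure condition, which yields a term at which some
    -- premise fails. The side formulas may be arbitrary, since they enter only through their truth
    -- values.
    rcases h.closed (T := .notationInd (t.subst σ) (s.subst σ) (ψ.subst (up (up σ))))
      ⟨⟨hψ.subst _, hW.subst _⟩, hs, (sat_φ _).2 hφ⟩ with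
      ⟨u, hu, htu⟩ | hε | ⟨a, ha, hφa, hsa⟩
    · exact (h₁ u ⟨hu, hΓ⟩).elim (sat_t u htu) hΔ
    · exact (h₂ hΓ).elim ((sat_φ _).1 hε) hΔ
    · have hφa := not_not.1 fun hn => h.notMem_right hφa ((sat_φ a).2 hn)
      rcases hsa with hsa | hsa
      · exact (h₃ a ⟨ha, hφa, hΓ⟩).elim ((sat_φ _).1 hsa) hΔ
      · exact (h₄ a ⟨ha, hφa, hΓ⟩).elim ((sat_φ _).1 hsa) hΔ
  | monotoneInd t s ψ hψ hW hO _ _ _ ih₁ ih₂ ih₃ =>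
    have h₁ u := ih₁ (scons u σ)
    have h₂ := ih₂ σ
    have h₃ a b := ih₃ (scons b (scons a σ))
    simp only [List.forall_mem_cons, List.exists_mem_cons_iff, forall_sat_liftAll_one,
      exists_sat_liftAll_one, forall_sat_liftAll_two, exists_sat_liftAll_two, sat_inst]
      at h₁ h₂ h₃ hΓ ⊢
    obtain ⟨hs, hΓ⟩ := hΓ
    by_contra hn
    obtain ⟨hφ, hΔ⟩ := not_or.1 hn
    have sat_φ := h.sat_exBounded (t := t) hψ σ
    have sat_t := h.not_sat_app_lift t σ
    rcases h.closed (T := .monotoneInd (t.subst σ) (s.subst σ) (ψ.subst (up (up σ))))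
      ⟨⟨hψ.subst _, hW.subst _, hO.subst _⟩, hs, (sat_φ _).2 hφ⟩ with
      ⟨u, hu, htu⟩ | hε | ⟨a, b, ha, hb, hφab, hm⟩
    · exact (h₁ u ⟨hu, hΓ⟩).elim (sat_t u htu) hΔ
    · exact (h₂ hΓ).elim ((sat_φ _).1 hε) hΔ
    · rw [← bounded_subst, subst_up_up_scons] at hφab
      rw [← exSucceq_subst hc, subst_up_up_scons] at hm
      exact (h₃ a b ⟨ha, hb, (h.truth _ _).1 hφab, hΓ⟩).elim ((h.truth _ _).2 hm) hΔ

end Saturated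

end APH

/-- Partial cut elimination for `APH⁺`. -/
theorem mainTheorem5 (c : APH.Term) (hc : c.Closed) :
    (∀ (t s : APH.Term) (ψ : APH.Formula), ψ.Positive → ψ.WFree → ψ.OrFree →
      (APH.Formula.W s).Positive ∧ ((APH.Formula.exBounded t ψ).inst s).Positive ∧
        (APH.Formula.bounded t ψ).Positive ∧ (APH.Formula.exSucceq c t ψ).Positive) ∧
    (∀ Γ Δ : List APH.Formula, APH.Provable c Γ Δ → APH.ProvablePosCut c Γ Δ) := by
  refine ⟨fun t s ψ hψ _ _ => ⟨trivial, (APH.Formula.exBounded_positive hψ).subst _,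
    APH.Formula.bounded_positive hψ, APH.Formula.exSucceq_positive hψ⟩, fun Γ Δ hd => ?_⟩
  by_contra hn
  obtain ⟨L, R, hS, hL, hR⟩ := APH.Unprovable.exists_saturated hc ⟨(Γ, Δ), hn⟩
  -- Under the identity assignment all of `Γ` is true and all of `Δ` false.
  obtain ⟨A, hA, hs⟩ := hS.sound hc hd APH.Term.var fun A hA =>
    (hS.truth A _).1 (by rw [A.subst_var]; exact hL hA)
  exact (hS.truth A _).2 (by rw [A.subst_var]; exact hR hA) hs
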